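/- Let $G$ be a connected simple graph with $n$ vertices and clique number $\omega\ge 2$, and write $n=k\omega+r$ with integers $k\ge 0$ and $0\le r<\omega$. Let $q_1(G)$ be the signless Laplacian spectral radius of $G$, that is, the largest eigenvalue of $Q(G)=D(G)+A(G)$, where $D(G)$ is the diagonal matrix of the vertex degrees and $A(G)$ is the adjacency matrix. Then $$q_1(G)\le\frac{(3\omega-4)k+3r-2+\sqrt{k^2\omega^2+[(2r+4)\omega-8r]k+(r-2)^2}}{2}.$$ Moreover, if $\omega=2$, equality holds if and only if $G$ is a complete bipartite graph; if $\omega\ge 3$, equality holds if and only if $G$ is (isomorphic to) the Turán graph $T_{n,\omega}$, the complete $\omega$-partite graph on $n$ vertices whose parts have sizes that pairwise differ by at most $1$. -/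

import Mathlib

namespace SimpleGraph

/-- The signless Laplacian matrix `Q(G) = D(G) + A(G)`, with real entries. -/
def signlessLapMatrix {V : Type*} [Fintype V] [DecidableEq V] (G : SimpleGraph V)
    [DecidableRel G.Adj] : Matrix V V ℝ :=
  G.degMatrix ℝ + G.adjMatrix ℝ

/-- The signless Laplacian spectral radius `q₁(G)`: the largest eigenvalue of `Q(G)`.
The supremum is a maximum as soon as there is a vertex; see
`isGreatest_signlessLapSpectralRadius`. -/
noncomputable def signlessLapSpectralRadius {V : Type*} [Fintype V] [DecidableEq V]
    (G : SimpleGraph V) [DecidableRel G.Adj] : ℝ :=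
  sSup {μ : ℝ | Module.End.HasEigenvalue (Matrix.toLin' G.signlessLapMatrix) μ}

theorem isHermitian_signlessLapMatrix {V : Type*} [Fintype V] [DecidableEq V]
    (G : SimpleGraph V) [DecidableRel G.Adj] : G.signlessLapMatrix.IsHermitian :=
  (G.isHermitian_degMatrix ℝ).add (G.isHermitian_adjMatrix ℝ)

theorem isGreatest_signlessLapSpectralRadius {V : Type*} [Fintype V] [DecidableEq V] [Nonempty V]
    (G : SimpleGraph V) [DecidableRel G.Adj] :
    IsGreatest {μ : ℝ | Module.End.HasEigenvalue (Matrix.toLin' G.signlessLapMatrix) μ}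
      G.signlessLapSpectralRadius := by
  have h : {μ : ℝ | Module.End.HasEigenvalue (Matrix.toLin' G.signlessLapMatrix) μ} =
      Set.range G.isHermitian_signlessLapMatrix.eigenvalues := by
    rw [← Matrix.IsHermitian.spectrum_real_eq_range_eigenvalues, ← Matrix.spectrum_toLin']
    ext μ
    exact Module.End.hasEigenvalue_iff_mem_spectrum
  unfold signlessLapSpectralRadius
  rw [h]
  exact ⟨(Set.range_nonempty _).csSup_mem (Set.finite_range _),
    fun x hx => le_csSup (Set.finite_range _).bddAbove hx⟩

/-- `G` is a complete bipartite graph `K_{p,q}` with `p, q ≥ 1`. -/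
def IsCompleteBipartite {V : Type*} (G : SimpleGraph V) : Prop :=
  ∃ p q : ℕ, 1 ≤ p ∧ 1 ≤ q ∧ Nonempty (G ≃g completeBipartiteGraph (Fin p) (Fin q))

end SimpleGraph

/-! Among the graphs on `V` without a clique of size `ω + 1`, one with the largest radius `q` is
complete multipartite, by Zykov symmetrization. Take a nonnegative eigenvector `x` of it, which
turns out to be positive. Turning a vertex into a clone of a non-neighbour, weight included, keeps
the graph clique-free and changes `x ⬝ᵥ Q *ᵥ x - q * (x ⬝ᵥ x)` by the difference of two values of
`vertexExcess`. If non-adjacency were not transitive, two clonings would make this form positive,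
which maximality of `q` forbids.

For classes of sizes `s i` and `t > 0`, the number `n + t` is an eigenvalue exactly when `∑ i, s i /
(t + 2 * s i) = 1`. The summand is concave in `s i`; measured against its chord between `k` and `k +
1`, the equation becomes a quadratic in `t`, depending only on `k`, `ω`, `r`, plus a nonnegative
defect that vanishes only if every size is `k` or `k + 1` (`sum_div_add_two_mul_eq`). Hence `t` is
at most the larger root, which is the stated bound.

A graph attaining the bound is itself a maximizer, hence complete multipartite. For `ω ≥ 3` the root
is positive and equality forces balanced classes. For `ω = 2` the root is `0`, and any two nonempty
classes attain it. -/

namespace SimpleGraph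

open Finset Matrix

/-! ### Quadratic form and Rayleigh principle -/

section Form

variable {V : Type*} [Fintype V]

open Classical in
/-- The quadratic form of the signless Laplacian. -/
noncomputable def signlessForm (G : SimpleGraph V) (x : V → ℝ) : ℝ :=
  (∑ u, ∑ w, if G.Adj u w then (x u + x w) ^ 2 else 0) / 2

open Classical in
/-- The contribution of the vertex `u` to `x ⬝ᵥ Q *ᵥ x - q * (x ⬝ᵥ x)`. -/
noncomputable def vertexExcess (G : SimpleGraph V) (q : ℝ) (x : V → ℝ) (u : V) : ℝ :=
  (∑ w, if G.Adj u w then (x u + x w) ^ 2 else 0) - q * x u ^ 2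

variable [DecidableEq V] (G : SimpleGraph V) [DecidableRel G.Adj]

theorem signlessLapMatrix_mulVec_apply (x : V → ℝ) (u : V) :
    (G.signlessLapMatrix *ᵥ x) u = ∑ w, if G.Adj u w then x u + x w else 0 := by
  rw [signlessLapMatrix, add_mulVec, Pi.add_apply, degMatrix, mulVec_diagonal,
    adjMatrix_mulVec_apply, ← card_neighborFinset_eq_degree, neighborFinset_eq_filter,
    sum_filter, ← sum_filter (fun w => G.Adj u w) (fun w => x u + x w), sum_add_distrib,
    sum_const, nsmul_eq_mul, sum_filter]

theorem dotProduct_signlessLapMatrix_mulVec (x : V → ℝ) :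
    x ⬝ᵥ G.signlessLapMatrix *ᵥ x = G.signlessForm x := by
  have h1 : x ⬝ᵥ G.signlessLapMatrix *ᵥ x =
      ∑ u, ∑ w, if G.Adj u w then x u * (x u + x w) else 0 := by
    simp only [dotProduct, signlessLapMatrix_mulVec_apply, mul_sum, mul_ite, mul_zero]
  have h2 : x ⬝ᵥ G.signlessLapMatrix *ᵥ x =
      ∑ u, ∑ w, if G.Adj u w then x w * (x u + x w) else 0 := by
    rw [h1, sum_comm]
    refine sum_congr rfl fun u _ => sum_congr rfl fun w _ => ?_
    simp only [G.adj_comm w u, add_comm (x w)]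
  have h3 : (∑ u, ∑ w, if G.Adj u w then (x u + x w) ^ 2 else 0) =
      (∑ u, ∑ w, if G.Adj u w then x u * (x u + x w) else 0) +
      ∑ u, ∑ w, if G.Adj u w then x w * (x u + x w) else 0 := by
    simp only [← sum_add_distrib]
    refine sum_congr rfl fun u _ => sum_congr rfl fun w _ => ?_
    split_ifs <;> ring
  have h4 : G.signlessForm x =
      (∑ u, ∑ w, if G.Adj u w then (x u + x w) ^ 2 else 0) / 2 := by
    unfold signlessForm
    congr!
  rw [h4, h3, ← h1, ← h2]
  ring

theorem posSemidef_signlessLapSpectralRadius_sub [Nonempty V] :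
    (algebraMap ℝ (Matrix V V ℝ) G.signlessLapSpectralRadius - G.signlessLapMatrix).PosSemidef := by
  rw [posSemidef_iff_isHermitian_and_spectrum_nonneg]
  refine ⟨IsHermitian.sub ?_ G.isHermitian_signlessLapMatrix, ?_⟩
  · rw [algebraMap_eq_diagonal]
    exact isHermitian_diagonal _
  · rw [← spectrum.singleton_sub_eq]
    rintro _ ⟨a, rfl, b, hb, rfl⟩
    have := mem_upperBounds.1 G.isGreatest_signlessLapSpectralRadius.2 b (by
      rw [← spectrum_toLin'] at hb
      exact Module.End.hasEigenvalue_iff_mem_spectrum.2 hb)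
    simpa using this

theorem dotProduct_algebraMap_sub_mulVec (q : ℝ) (A : Matrix V V ℝ) (x : V → ℝ) :
    x ⬝ᵥ (algebraMap ℝ (Matrix V V ℝ) q - A) *ᵥ x = q * (x ⬝ᵥ x) - x ⬝ᵥ A *ᵥ x := by
  rw [sub_mulVec, dotProduct_sub, Algebra.algebraMap_eq_smul_one, smul_mulVec, one_mulVec,
    dotProduct_smul, smul_eq_mul]

theorem signlessForm_le [Nonempty V] (x : V → ℝ) :
    G.signlessForm x ≤ G.signlessLapSpectralRadius * (x ⬝ᵥ x) := by
  have h := G.posSemidef_signlessLapSpectralRadius_sub.re_dotProduct_nonneg x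
  rw [star_trivial, dotProduct_algebraMap_sub_mulVec, dotProduct_signlessLapMatrix_mulVec] at h
  simpa using h

theorem signlessLapMatrix_mulVec_of_signlessForm_eq [Nonempty V] {x : V → ℝ}
    (hx : G.signlessForm x = G.signlessLapSpectralRadius * (x ⬝ᵥ x)) :
    G.signlessLapMatrix *ᵥ x = G.signlessLapSpectralRadius • x := by
  have h := (G.posSemidef_signlessLapSpectralRadius_sub.dotProduct_mulVec_zero_iff x).1 (by
    rw [star_trivial, dotProduct_algebraMap_sub_mulVec, dotProduct_signlessLapMatrix_mulVec, hx,
      sub_self])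
  rw [sub_mulVec, Algebra.algebraMap_eq_smul_one, smul_mulVec, one_mulVec, sub_eq_zero] at h
  exact h.symm

theorem le_signlessLapSpectralRadius [Nonempty V] {x : V → ℝ} {μ : ℝ} (hx : x ≠ 0)
    (h : G.signlessLapMatrix *ᵥ x = μ • x) : μ ≤ G.signlessLapSpectralRadius := by
  refine G.isGreatest_signlessLapSpectralRadius.2 (Module.End.hasEigenvalue_of_hasEigenvector
    (x := x) ⟨Module.End.mem_eigenspace_iff.2 ?_, hx⟩)
  rw [toLin'_apply, h]

/-- Passing from `x` to `|x|` keeps the norm and does not decrease the form, so `|x|` still attains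
the Rayleigh maximum and is an eigenvector. -/
theorem exists_nonneg_eigenvector [Nonempty V] :
    ∃ x : V → ℝ, x ≠ 0 ∧ 0 ≤ x ∧
      G.signlessLapMatrix *ᵥ x = G.signlessLapSpectralRadius • x := by
  obtain ⟨x, hx⟩ := G.isGreatest_signlessLapSpectralRadius.1.exists_hasEigenvector
  have hx' : G.signlessLapMatrix *ᵥ x = G.signlessLapSpectralRadius • x := by
    rw [← toLin'_apply]; exact hx.apply_eq_smul
  refine ⟨fun v => |x v|, fun h => hx.2 (funext fun v => abs_eq_zero.1 (congrFun h v)),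
    fun v => abs_nonneg _, G.signlessLapMatrix_mulVec_of_signlessForm_eq
      (le_antisymm (G.signlessForm_le _) ?_)⟩
  have h1 : ((fun v => |x v|) ⬝ᵥ fun v => |x v|) = x ⬝ᵥ x := by simp [dotProduct]
  have h2 : G.signlessForm x = G.signlessLapSpectralRadius * (x ⬝ᵥ x) := by
    rw [← dotProduct_signlessLapMatrix_mulVec, hx', dotProduct_smul, smul_eq_mul]
  rw [h1, ← h2]
  unfold signlessForm
  gcongr with u _ w _
  split_ifs
  · rw [← sq_abs (x u + x w)]
    gcongr
    exact abs_add_le _ _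
  · rfl

theorem signlessLapSpectralRadius_pos [Nonempty V] {a b : V} (h : G.Adj a b) :
    0 < G.signlessLapSpectralRadius := by
  have h1 := G.signlessForm_le (Pi.single a 1)
  rw [← dotProduct_signlessLapMatrix_mulVec, single_dotProduct, single_dotProduct,
    signlessLapMatrix_mulVec_apply, Pi.single_eq_same, one_mul, mul_one, mul_one] at h1
  refine lt_of_lt_of_le (sum_pos' (fun w _ => ?_) ⟨b, mem_univ b, ?_⟩) h1
  · have : 0 ≤ (Pi.single a 1 : V → ℝ) w := by
      rw [Pi.single_apply]
      positivity
    split_ifs <;> linarith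
  · simp [h, h.ne']

end Form

/-! ### Zykov symmetrization -/

section Zykov

theorem ite_zero_congr {a b : Prop} {_ : Decidable a} {_ : Decidable b} {x y : ℝ} (h : a ↔ b)
    (hxy : x = y) : (if a then x else 0) = if b then y else 0 :=
  if_congr h hxy rfl

variable {V : Type*} [Fintype V] [DecidableEq V] (G : SimpleGraph V)

theorem sum_sum_eq_of_symmetric {F : V → V → ℝ} (t : V) (hF : ∀ u w, F u w = F w u)
    (ht : F t t = 0) :
    ∑ u, ∑ w, F u w = (∑ u ∈ univ.erase t, ∑ w ∈ univ.erase t, F u w) + 2 * ∑ w, F t w := by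
  rw [← add_sum_erase univ _ (mem_univ t)]
  have h : ∀ u, ∑ w, F u w = F t u + ∑ w ∈ univ.erase t, F u w := fun u => by
    rw [← add_sum_erase univ _ (mem_univ t), hF u t]
  rw [sum_congr rfl fun u (_ : u ∈ univ.erase t) => h u, sum_add_distrib,
    ← add_sum_erase univ (F t) (mem_univ t), ht]
  ring

theorem signlessForm_eq_vertexExcess (q : ℝ) (x : V → ℝ) (t : V) :
    G.signlessForm x - q * (x ⬝ᵥ x) =
      ((∑ u ∈ univ.erase t, ∑ w ∈ univ.erase t, open Classical in
        if G.Adj u w then (x u + x w) ^ 2 else 0) / 2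
        - q * ∑ u ∈ univ.erase t, x u ^ 2) + G.vertexExcess q x t := by
  classical
  have h : (x ⬝ᵥ x) = x t ^ 2 + ∑ u ∈ univ.erase t, x u ^ 2 := by
    rw [add_sum_erase univ (fun u => x u ^ 2) (mem_univ t)]
    simp only [dotProduct, sq]
  rw [signlessForm, sum_sum_eq_of_symmetric t (fun u w => by rw [G.adj_comm, add_comm (x u)])
    (by simp), h, vertexExcess]
  ring

theorem vertexExcess_replaceVertex {s t : V} (hst : ¬ G.Adj s t) (q : ℝ) (x : V → ℝ) :
    (G.replaceVertex s t).vertexExcess q (Function.update x t (x s)) t =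
      G.vertexExcess q x s := by
  unfold vertexExcess
  rw [Function.update_self]
  congr 1
  refine sum_congr rfl fun w _ => ?_
  rcases eq_or_ne w t with rfl | hw
  · simp [hst]
  · rw [Function.update_of_ne hw]
    exact ite_zero_congr (G.adj_replaceVertex_iff_of_ne_right s hw) rfl

/-- Only the terms at `t` change, and since `s` and `t` are not adjacent, the clone at `t` has the
old excess of `s`. -/
theorem signlessForm_replaceVertex {s t : V} (hst : ¬ G.Adj s t) (q : ℝ) (x : V → ℝ) :
    (G.replaceVertex s t).signlessForm (Function.update x t (x s)) -
        q * (Function.update x t (x s) ⬝ᵥ Function.update x t (x s)) =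
      G.signlessForm x - q * (x ⬝ᵥ x) + (G.vertexExcess q x s - G.vertexExcess q x t) := by
  rw [signlessForm_eq_vertexExcess _ _ _ t, signlessForm_eq_vertexExcess _ _ x t,
    vertexExcess_replaceVertex G hst]
  have h1 : ∀ u ∈ univ.erase t, Function.update x t (x s) u = x u := fun u hu =>
    Function.update_of_ne (ne_of_mem_erase hu) ..
  have h2 : ∑ u ∈ univ.erase t, Function.update x t (x s) u ^ 2 = ∑ u ∈ univ.erase t, x u ^ 2 :=
    sum_congr rfl fun u hu => by rw [h1 u hu]
  rw [h2, sum_congr rfl fun u hu => sum_congr rfl fun w hw => ite_zero_congr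
    (G.adj_replaceVertex_iff_of_ne s (ne_of_mem_erase hu) (ne_of_mem_erase hw))
    (by rw [h1 u hu, h1 w hw])]
  ring

theorem vertexExcess_replaceVertex_self {s t : V} (hne : s ≠ t) (hst : ¬ G.Adj s t) (q : ℝ)
    (x : V → ℝ) :
    (G.replaceVertex s t).vertexExcess q (Function.update x t (x s)) s =
      G.vertexExcess q x s := by
  unfold vertexExcess
  rw [Function.update_of_ne hne]
  congr 1
  refine sum_congr rfl fun w _ => ?_
  rcases eq_or_ne w t with rfl | hw
  · simp [hst, G.not_adj_replaceVertex_same]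
  · rw [Function.update_of_ne hw]
    exact ite_zero_congr (G.adj_replaceVertex_iff_of_ne_left s hw) rfl

/-- The clone of `s` at `t` drops the edge to `w`. This lost term is the strict gain when `t` and
`w` are both replaced. -/
theorem vertexExcess_replaceVertex_of_adj {s t w : V} (htw : G.Adj t w)
    (hsw : ¬ G.Adj s w) (q : ℝ) (x : V → ℝ) :
    (G.replaceVertex s t).vertexExcess q (Function.update x t (x s)) w =
      G.vertexExcess q x w - (x t + x w) ^ 2 := by
  classical
  unfold vertexExcess
  rw [Function.update_of_ne htw.ne', ← add_sum_erase univ _ (mem_univ t),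
    ← add_sum_erase univ (fun v => if G.Adj w v then (x w + x v) ^ 2 else 0) (mem_univ t),
    if_pos htw.symm, if_neg (by
      rw [adj_comm, G.adj_replaceVertex_iff_of_ne_right s htw.ne']; exact hsw)]
  have e : ∀ {a b c d : ℝ}, a = b → 0 + a - c = d + b - c - d := by
    rintro a _ c d rfl
    ring
  rw [add_comm (x t)]
  exact e (sum_congr rfl fun v hv => ite_zero_congr
    (G.adj_replaceVertex_iff_of_ne s htw.ne' (ne_of_mem_erase hv))
    (by rw [Function.update_of_ne (ne_of_mem_erase hv)]))

/-- A positive vector attaining the maximum of the form over `m`-clique-free graphs lives on a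
complete multipartite graph. -/
theorem isCompleteMultipartite_of_signlessForm_maximal {q : ℝ} {m : ℕ} (hG : G.CliqueFree m)
    (hmax : ∀ H : SimpleGraph V, H.CliqueFree m → ∀ y, H.signlessForm y ≤ q * (y ⬝ᵥ y))
    {x : V → ℝ} (hx : ∀ v, 0 < x v) (hGx : G.signlessForm x = q * (x ⬝ᵥ x)) :
    G.IsCompleteMultipartite := by
  have key : ∀ {s t : V}, ¬ G.Adj s t → G.vertexExcess q x s ≤ G.vertexExcess q x t := by
    intro s t hst
    have h1 := G.signlessForm_replaceVertex hst q x
    have h2 := hmax _ (hG.replaceVertex s t) (Function.update x t (x s))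
    linarith
  refine ⟨fun u v w huv hvw huw => ?_⟩
  have hvu : ¬ G.Adj v u := fun h => huv h.symm
  have hne : v ≠ u := by rintro rfl; exact hvw huw
  have hne' : v ≠ w := by rintro rfl; exact huv huw
  have h1 := G.signlessForm_replaceVertex hvu q x
  have hvw' : ¬ (G.replaceVertex v u).Adj v w := by
    rwa [G.adj_replaceVertex_iff_of_ne_left v huw.ne']
  -- Cloning `v` onto both `u` and `w` subtracts the excesses of `u` and `w`, which count the edge
  -- `uw` twice; the total change is thus at least `(x u + x w) ^ 2`.
  have h2 := (G.replaceVertex v u).signlessForm_replaceVertex hvw' q (Function.update x u (x v))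
  have h3 := hmax _ ((hG.replaceVertex v u).replaceVertex v w)
    (Function.update (Function.update x u (x v)) w (Function.update x u (x v) v))
  rw [vertexExcess_replaceVertex_self G hne hvu,
    vertexExcess_replaceVertex_of_adj G huw hvw] at h2
  have h4 := key huv
  have h5 := key (s := w) (t := v) fun h => hvw h.symm
  have h6 : 0 < (x u + x w) ^ 2 := by have := hx u; have := hx w; positivity
  linarith

theorem vertexExcess_eq_of_eigenvector [DecidableRel G.Adj] {q : ℝ} {x : V → ℝ}
    (h : G.signlessLapMatrix *ᵥ x = q • x) (u : V) :
    G.vertexExcess q x u = ∑ w, if G.Adj u w then x w * (x u + x w) else 0 := by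
  have h1 := congrFun h u
  rw [signlessLapMatrix_mulVec_apply, Pi.smul_apply, smul_eq_mul] at h1
  have h2 : q * x u ^ 2 = ∑ w, if G.Adj u w then x u * (x u + x w) else 0 := by
    simp only [← mul_ite_zero, ← mul_sum, h1]
    ring
  rw [vertexExcess, h2, sub_eq_iff_eq_add, ← sum_add_distrib]
  refine sum_congr rfl fun w _ => ?_
  split_ifs <;> ring

/-- A zero of `x` spreads to its neighbours, so its excess is `0`. Cloning a vertex of nonzero
weight onto it would increase the form unless that vertex is isolated, and `0 < q` excludes this. -/
theorem pos_of_signlessForm_maximal [DecidableRel G.Adj] {q : ℝ} (hq : 0 < q) {m : ℕ}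
    (hG : G.CliqueFree m)
    (hmax : ∀ H : SimpleGraph V, H.CliqueFree m → ∀ y, H.signlessForm y ≤ q * (y ⬝ᵥ y))
    {x : V → ℝ} (hx0 : x ≠ 0) (hx : 0 ≤ x) (h : G.signlessLapMatrix *ᵥ x = q • x) (v : V) :
    0 < x v := by
  have hGx : G.signlessForm x = q * (x ⬝ᵥ x) := by
    rw [← dotProduct_signlessLapMatrix_mulVec, h, dotProduct_smul, smul_eq_mul]
  have hnbr : ∀ {a b}, x a = 0 → G.Adj a b → x b = 0 := by
    intro a b ha hab
    have h1 := congrFun h a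
    rw [signlessLapMatrix_mulVec_apply, Pi.smul_apply, smul_eq_mul, ha, mul_zero,
      sum_eq_zero_iff_of_nonneg (fun w _ => by have := hx w; split_ifs <;> simp_all)] at h1
    simpa [hab] using h1 b (mem_univ b)
  refine (hx v).lt_of_ne fun hv => hx0 (funext fun u => ?_)
  by_contra hu
  have huv : ¬ G.Adj u v := fun huv => hu (hnbr hv.symm huv.symm)
  have h1 := G.signlessForm_replaceVertex huv q x
  have h2 := hmax _ (hG.replaceVertex u v) (Function.update x v (x u))
  have h3 : G.vertexExcess q x v = 0 := by
    rw [G.vertexExcess_eq_of_eigenvector h]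
    refine sum_eq_zero fun w _ => ?_
    split_ifs with hw
    · rw [hnbr hv.symm hw, zero_mul]
    · rfl
  have h4 : ∀ w ∈ univ, 0 ≤ if G.Adj u w then x w * (x u + x w) else 0 := fun w _ => by
    have h5 := hx w
    have h6 := hx u
    simp only [Pi.zero_apply] at h5 h6
    positivity
  have h5 : ∑ w, (if G.Adj u w then x w * (x u + x w) else 0) = 0 :=
    le_antisymm (by rw [← G.vertexExcess_eq_of_eigenvector h]; linarith) (sum_nonneg h4)
  rw [sum_eq_zero_iff_of_nonneg h4] at h5
  have hno : ∀ w, ¬ G.Adj u w := by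
    intro w hw
    have h6 := h5 w (mem_univ w)
    rw [if_pos hw, mul_eq_zero] at h6
    refine hu (hnbr (h6.resolve_right fun h7 => hu ?_) hw.symm)
    have h8 := hx w
    have h9 := hx u
    simp only [Pi.zero_apply] at h8 h9 ⊢
    linarith
  have h6 := congrFun h u
  rw [signlessLapMatrix_mulVec_apply, sum_eq_zero fun w _ => if_neg (hno w), Pi.smul_apply,
    smul_eq_mul, eq_comm, mul_eq_zero] at h6
  exact h6.elim hq.ne' hu

/-- A clique-free graph of maximal signless Laplacian spectral radius is complete multipartite. -/
theorem isCompleteMultipartite_of_isMax [Nonempty V] [DecidableRel G.Adj] {m : ℕ}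
    (hG : G.CliqueFree m) (hpos : 0 < G.signlessLapSpectralRadius)
    (hmax : ∀ (H : SimpleGraph V) [DecidableRel H.Adj], H.CliqueFree m →
      H.signlessLapSpectralRadius ≤ G.signlessLapSpectralRadius) :
    G.IsCompleteMultipartite := by
  classical
  have hmax' : ∀ H : SimpleGraph V, H.CliqueFree m → ∀ y,
      H.signlessForm y ≤ G.signlessLapSpectralRadius * (y ⬝ᵥ y) := fun H hH y =>
    (H.signlessForm_le y).trans
      (mul_le_mul_of_nonneg_right (hmax H hH) (by simpa using dotProduct_star_self_nonneg y))
  obtain ⟨x, hx0, hx, h⟩ := G.exists_nonneg_eigenvector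
  refine G.isCompleteMultipartite_of_signlessForm_maximal hG hmax'
    (G.pos_of_signlessForm_maximal hpos hG hmax' hx0 hx h) ?_
  rw [← dotProduct_signlessLapMatrix_mulVec, h, dotProduct_smul, smul_eq_mul]

theorem exists_isMax_signlessLapSpectralRadius (m : ℕ) (hG : G.CliqueFree m) :
    ∃ (H : SimpleGraph V) (_ : DecidableRel H.Adj), H.CliqueFree m ∧
      ∀ (K : SimpleGraph V) [DecidableRel K.Adj], K.CliqueFree m →
        K.signlessLapSpectralRadius ≤ H.signlessLapSpectralRadius := by
  obtain ⟨H, hH, hmax⟩ := Set.exists_max_image {H : SimpleGraph V | H.CliqueFree m}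
    (fun H => @signlessLapSpectralRadius V _ _ H (Classical.decRel _)) (Set.toFinite _) ⟨G, hG⟩
  refine ⟨H, Classical.decRel _, hH, fun K i hK => ?_⟩
  rw [Subsingleton.elim i (Classical.decRel _)]
  exact hmax K hK

end Zykov

/-! ### Eigenvalues of complete multipartite graphs -/

section Multipartite

variable {V ι : Type*} [Fintype V] [DecidableEq V] [DecidableEq ι]
  {G : SimpleGraph V} [DecidableRel G.Adj] {c : V → ι}

theorem signlessLapMatrix_mulVec_of_multipartite (hc : ∀ u v, G.Adj u v ↔ c u ≠ c v)
    (x : V → ℝ) (v : V) :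
    (G.signlessLapMatrix *ᵥ x) v =
      (Fintype.card V - #{w | c w = c v}) * x v + ∑ w, x w - ∑ w with c w = c v, x w := by
  have h : ∀ w, (if G.Adj v w then x v + x w else 0) =
      (x v + x w) - if c w = c v then x v + x w else 0 := by
    intro w
    simp only [hc, ne_comm (a := c v)]
    split_ifs <;> simp_all
  rw [signlessLapMatrix_mulVec_apply, sum_congr rfl fun w _ => h w, sum_sub_distrib,
    ← sum_filter, sum_add_distrib, sum_add_distrib, sum_const, sum_const, card_univ,
    nsmul_eq_mul, nsmul_eq_mul]
  ring

theorem sum_class_card_div_eq_one [Fintype ι]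
    (hc : ∀ u v, G.Adj u v ↔ c u ≠ c v) {x : V → ℝ} (hx : x ≠ 0) {t : ℝ} (ht : 0 < t)
    (h : G.signlessLapMatrix *ᵥ x = (Fintype.card V + t) • x) :
    ∑ i, (#{w | c w = i} : ℝ) / (t + 2 * #{w | c w = i}) = 1 := by
  have hv : ∀ v, (t + #{w | c w = c v}) * x v = ∑ w, x w - ∑ w with c w = c v, x w := by
    intro v
    have h1 := congrFun h v
    rw [signlessLapMatrix_mulVec_of_multipartite hc, Pi.smul_apply, smul_eq_mul] at h1
    linarith
  -- Summing the eigenvalue equation over a class determines the class sum; adding the class sums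
  -- then gives the identity.
  have hi : ∀ i, ∑ w with c w = i, x w =
      (∑ w, x w) * ((#{w | c w = i} : ℝ) / (t + 2 * #{w | c w = i})) := by
    intro i
    have h1 : (t + #{w | c w = i}) * ∑ w with c w = i, x w =
        #{w | c w = i} * (∑ w, x w - ∑ w with c w = i, x w) := by
      rw [mul_sum, ← nsmul_eq_mul, ← sum_const]
      refine sum_congr rfl fun v hv' => ?_
      obtain rfl := (mem_filter.1 hv').2
      exact hv v
    have h2 : 0 < t + 2 * (#{w | c w = i} : ℝ) := by positivity
    field_simp
    linarith
  have hS : ∑ w, x w ≠ 0 := by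
    intro h0
    refine hx (funext fun v => ?_)
    have h1 := hv v
    rw [hi, h0] at h1
    have h2 : 0 < t + (#{w | c w = c v} : ℝ) := by positivity
    simpa [h2.ne'] using h1
  refine mul_left_cancel₀ hS ?_
  rw [mul_sum, mul_one, ← sum_congr rfl fun i _ => hi i]
  exact sum_fiberwise univ c x

/-- The vector with value `1 / (t + 2 * s)` on a class of size `s` is an eigenvector. The case `t =
0` is needed for bipartite graphs. -/
theorem card_add_le_signlessLapSpectralRadius [Fintype ι] [Nonempty V]
    (hc : ∀ u v, G.Adj u v ↔ c u ≠ c v) {t : ℝ} (ht : 0 ≤ t)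
    (h : ∑ i, (#{w | c w = i} : ℝ) / (t + 2 * #{w | c w = i}) = 1) :
    Fintype.card V + t ≤ G.signlessLapSpectralRadius := by
  have hpos : ∀ v, 0 < t + 2 * (#{w | c w = c v} : ℝ) := by
    intro v
    have : 0 < #{w | c w = c v} := card_pos.2 ⟨v, by simp⟩
    positivity
  have hi : ∀ i, ∑ w with c w = i, (t + 2 * (#{w' | c w' = c w} : ℝ))⁻¹ =
      (#{w | c w = i} : ℝ) / (t + 2 * #{w | c w = i}) := by
    intro i
    rw [div_eq_mul_inv, ← nsmul_eq_mul, ← sum_const]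
    refine sum_congr rfl fun w hw => ?_
    rw [(mem_filter.1 hw).2]
  refine le_signlessLapSpectralRadius G (x := fun v => (t + 2 * (#{w | c w = c v} : ℝ))⁻¹)
    (fun h0 => ?_) (funext fun v => ?_)
  · obtain ⟨v⟩ := ‹Nonempty V›
    exact (inv_pos.2 (hpos v)).ne' (congrFun h0 v)
  · rw [signlessLapMatrix_mulVec_of_multipartite hc, hi,
      ← sum_fiberwise univ c, sum_congr rfl fun i _ => hi i, h, Pi.smul_apply, smul_eq_mul]
    have e := mul_inv_cancel₀ (hpos v).ne'
    rw [div_eq_mul_inv]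
    linear_combination -e

end Multipartite

/-- Representatives of the classes form a clique, so there are at most `m` classes; some colours may
stay unused. -/
theorem exists_coloring_of_isCompleteMultipartite {V : Type*} [Fintype V] {G : SimpleGraph V}
    (h : G.IsCompleteMultipartite) {m : ℕ}
    (hm : G.CliqueFree (m + 1)) : ∃ c : V → Fin m, ∀ u v, G.Adj u v ↔ c u ≠ c v := by
  classical
  have hadj : ∀ u v, G.Adj u v ↔ (⟦u⟧ : Quotient h.setoid) ≠ ⟦v⟧ := fun u v => by
    rw [Ne, Quotient.eq]
    exact not_not.symm
  have hcard : Fintype.card (Quotient h.setoid) ≤ Fintype.card (Fin m) := by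
    rw [Fintype.card_fin]
    by_contra! hlt
    refine hm.mono (Nat.succ_le_of_lt hlt)
      (univ.map ⟨Quotient.out (s := h.setoid), Quotient.out_injective⟩)
      ⟨?_, by rw [card_map, card_univ]⟩
    intro a ha b hb hab
    rw [mem_coe, mem_map] at ha hb
    obtain ⟨a, -, rfl⟩ := ha
    obtain ⟨b, -, rfl⟩ := hb
    rw [hadj]
    intro hq
    refine hab (congrArg _ ?_)
    rwa [← a.out_eq, ← b.out_eq]
  obtain ⟨f⟩ := Function.Embedding.nonempty_of_card_le hcard
  exact ⟨fun v => f ⟦v⟧, fun u v => by rw [hadj, f.injective.ne_iff]⟩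

/-! ### Unbalanced class sizes -/

section Balance

theorem sum_div_add_two_mul_eq {ι : Type*} [Fintype ι] {s : ι → ℕ} {k r ω : ℕ}
    (hι : Fintype.card ι = ω) (hs : ∑ i, s i = k * ω + r) {t : ℝ} (ht : 0 < t) :
    ∑ i, (s i : ℝ) / (t + 2 * s i) = 1 -
      (t ^ 2 + (4 * k + 2 - (k * ω + r)) * t - 2 * k * (k + 1) * (ω - 2) +
        ∑ i, 2 * t * (((s i : ℝ) - k) * (s i - k - 1)) / (t + 2 * s i)) /
        ((t + 2 * k) * (t + 2 * k + 2)) := by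
  -- The chord of `s / (t + 2 * s)` through `s = k` and `s = k + 1`, minus the deviation from it.
  have h : ∀ i, (s i : ℝ) / (t + 2 * s i) =
      (k : ℝ) / (t + 2 * k) + (s i - k) * (t / ((t + 2 * k) * (t + 2 * k + 2))) -
      (2 * t * (((s i : ℝ) - k) * (s i - k - 1)) / (t + 2 * s i)) /
        ((t + 2 * k) * (t + 2 * k + 2)) := by
    intro i
    field_simp
    ring
  have hs' : ∑ i, (s i : ℝ) = k * ω + r := by exact_mod_cast hs
  rw [sum_congr rfl fun i _ => h i, sum_sub_distrib, sum_add_distrib, ← sum_mul,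
    sum_sub_distrib, sum_const, sum_const, card_univ, hι, hs', ← sum_div, nsmul_eq_mul,
    nsmul_eq_mul]
  generalize ∑ i, 2 * t * (((s i : ℝ) - k) * (s i - k - 1)) / (t + 2 * s i) = D
  field_simp
  ring

theorem sub_mul_sub_sub_one_nonneg (m k : ℕ) : 0 ≤ ((m : ℝ) - k) * (m - k - 1) := by
  rcases le_or_gt m k with h | h
  · have : (m : ℝ) ≤ k := by exact_mod_cast h
    nlinarith
  · have : (k : ℝ) + 1 ≤ m := by exact_mod_cast h
    exact mul_nonneg (by linarith) (by linarith)

end Balance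

/-! ### Colourings versus Turán and complete bipartite graphs -/

section Isomorphism

variable {V : Type*} [Fintype V] {G : SimpleGraph V}

theorem nonempty_iso_turanGraph_of_balanced {n k ω : ℕ} (hn : Fintype.card V = n) (hk : 1 ≤ k)
    {c : V → Fin ω} (hc : ∀ u v, G.Adj u v ↔ c u ≠ c v)
    (hs : ∀ i, #{w | c w = i} = k ∨ #{w | c w = i} = k + 1) :
    Nonempty (G ≃g turanGraph n ω) := by
  classical
  subst hn
  let P : Finpartition (univ : Finset V) := Finpartition.ofSetoid (Setoid.ker c)
  have hpart : ∀ v, P.part v = ({w | c w = c v} : Finset V) := fun v => by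
    ext w
    rw [Finpartition.mem_part_ofSetoid_iff_rel, mem_filter_univ, Setoid.ker_def, eq_comm]
  have hne : ∀ i, ∃ v, c v = i := fun i => by
    have : 0 < #{w | c w = i} := by rcases hs i with h | h <;> omega
    obtain ⟨v, hv⟩ := card_pos.1 this
    exact ⟨v, (mem_filter.1 hv).2⟩
  have hparts : P.parts = univ.image fun i => ({w | c w = i} : Finset V) := by
    ext p
    rw [mem_image]
    constructor
    · intro hp
      obtain ⟨v, hv⟩ := P.nonempty_of_mem_parts hp
      exact ⟨c v, mem_univ _, by rw [← hpart, P.part_eq_of_mem hp hv]⟩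
    · rintro ⟨i, -, rfl⟩
      obtain ⟨v, rfl⟩ := hne i
      rw [← hpart]
      exact P.part_mem.2 (mem_univ v)
  have hcard : #P.parts = ω := by
    rw [hparts, card_image_of_injective, card_univ, Fintype.card_fin]
    intro i j hij
    obtain ⟨v, rfl⟩ := hne i
    have : v ∈ ({w | c w = c v} : Finset V) := by simp
    rw [show ({w | c w = c v} : Finset V) = ({w | c w = j} : Finset V) from hij] at this
    exact (mem_filter.1 this).2
  have hP : P.IsEquipartition := by
    rw [Finpartition.IsEquipartition, Set.equitableOn_iff_exists_le_le_add_one]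
    refine ⟨k, fun p hp => ?_⟩
    rw [mem_coe, hparts, mem_image] at hp
    obtain ⟨i, -, rfl⟩ := hp
    rcases hs i with h | h <;> omega
  -- This numbers the vertices so that sharing a part means congruence modulo the number of parts.
  -- That number is `ω` because `1 ≤ k` leaves no class empty.
  obtain ⟨f, hf⟩ := hP.exists_partPreservingEquiv
  refine ⟨⟨(Equiv.subtypeUnivEquiv mem_univ).symm.trans f, fun {a b} => ?_⟩⟩
  have h := hf ⟨a, mem_univ a⟩ ⟨b, mem_univ b⟩
  rw [hcard] at h
  change (f ⟨a, mem_univ a⟩ : ℕ) % ω ≠ (f ⟨b, mem_univ b⟩ : ℕ) % ω ↔ G.Adj a b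
  rw [hc, not_iff_not, ← h, hpart, hpart]
  constructor
  · intro h
    have : a ∈ ({w | c w = c a} : Finset V) := by simp
    rw [h] at this
    exact (mem_filter.1 this).2
  · intro h
    rw [h]

theorem exists_balanced_coloring_of_iso_turanGraph {n k ω r : ℕ} (hω : 0 < ω)
    (hn : n = k * ω + r) (hr : r < ω) (e : G ≃g turanGraph n ω) :
    ∃ c : V → Fin ω, (∀ u v, G.Adj u v ↔ c u ≠ c v) ∧
      ∀ i, #{w | c w = i} = k ∨ #{w | c w = i} = k + 1 := by
  refine ⟨fun v => ⟨e v % ω, Nat.mod_lt _ hω⟩, fun u v => ?_, fun i => ?_⟩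
  · rw [← e.map_adj_iff, turanGraph_adj, Ne, Ne, Fin.mk.injEq]
  · have h : #{w | (⟨e w % ω, Nat.mod_lt _ hω⟩ : Fin ω) = i} =
        n.count (· ≡ i [MOD ω]) := by
      rw [Nat.count_eq_card_filter_range, card_filter, card_filter,
        ← Fin.sum_univ_eq_sum_range (fun x => if x ≡ i [MOD ω] then 1 else 0),
        ← e.toEquiv.sum_comp]
      refine sum_congr rfl fun w _ => if_congr ?_ rfl rfl
      rw [Fin.ext_iff, Nat.ModEq, Nat.mod_eq_of_lt i.2]
      rfl
    have hdiv : n / ω = k := by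
      rw [hn, mul_comm, Nat.mul_add_div hω, Nat.div_eq_of_lt hr, add_zero]
    rw [h, Nat.count_modEq_card _ hω, hdiv]
    split_ifs <;> simp

theorem isCompleteBipartite_iff : G.IsCompleteBipartite ↔
    ∃ c : V → Fin 2, (∀ u v, G.Adj u v ↔ c u ≠ c v) ∧ ∀ i, 0 < #{w | c w = i} := by
  classical
  constructor
  · rintro ⟨p, q, hp, hq, ⟨e⟩⟩
    refine ⟨fun v => if (e v).isLeft then 0 else 1, fun u v => ?_, fun i => card_pos.2 ?_⟩
    · rw [← e.map_adj_iff]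
      rcases hu : e u <;> rcases hv : e v <;> simp [hu, hv]
    · fin_cases i
      · exact ⟨e.symm (.inl ⟨0, hp⟩), by simp⟩
      · exact ⟨e.symm (.inr ⟨0, hq⟩), by simp⟩
  · rintro ⟨c, hc, hs⟩
    have h2 : ∀ v, ¬ c v = 0 ↔ c v = 1 := fun v => by
      have : ∀ i : Fin 2, ¬ i = 0 ↔ i = 1 := by decide
      exact this _
    refine ⟨Fintype.card {v // c v = 0}, Fintype.card {v // ¬ c v = 0}, ?_, ?_, ⟨?_⟩⟩
    · rw [Fintype.card_subtype]
      exact hs 0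
    · rw [Fintype.card_subtype]
      simp only [h2]
      exact hs 1
    · let f : {v // c v = 0} ⊕ {v // ¬ c v = 0} ≃ V := Equiv.sumCompl _
      refine RelIso.symm ⟨(Equiv.sumCongr (Fintype.equivFin _) (Fintype.equivFin _)).symm.trans f,
        fun {a b} => ?_⟩
      rw [hc]
      rcases a with a | a <;> rcases b with b | b
      · simpa [f] using ((Fintype.equivFin {v // c v = 0}).symm a).2.trans
          ((Fintype.equivFin {v // c v = 0}).symm b).2.symm
      · simpa [f] using fun h => ((Fintype.equivFin {v // ¬ c v = 0}).symm b).2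
          (h.symm.trans ((Fintype.equivFin {v // c v = 0}).symm a).2)
      · simpa [f] using fun h => ((Fintype.equivFin {v // ¬ c v = 0}).symm a).2
          (h.trans ((Fintype.equivFin {v // c v = 0}).symm b).2)
      · simpa [f] using ((h2 _).1 ((Fintype.equivFin {v // ¬ c v = 0}).symm a).2).trans
          ((h2 _).1 ((Fintype.equivFin {v // ¬ c v = 0}).symm b).2).symm

end Isomorphism

/-! ### Larger root of a quadratic -/

section Bound

/-- The larger root of `t ^ 2 + b * t = c`. -/
noncomputable def largerRoot (b c : ℝ) : ℝ := (-b + √(b ^ 2 + 4 * c)) / 2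

theorem largerRoot_nonneg {b c : ℝ} (hc : 0 ≤ c) : 0 ≤ largerRoot b c := by
  have : b ≤ √(b ^ 2 + 4 * c) := Real.le_sqrt_of_sq_le (by linarith)
  unfold largerRoot
  linarith

theorem largerRoot_pos {b c : ℝ} (hc : 0 < c) : 0 < largerRoot b c := by
  have : |b| < √(b ^ 2 + 4 * c) := by
    rw [← Real.sqrt_sq_eq_abs]
    exact Real.sqrt_lt_sqrt (sq_nonneg b) (by linarith)
  have := le_abs_self b
  unfold largerRoot
  linarith

theorem largerRoot_zero {b : ℝ} (hb : 0 ≤ b) : largerRoot b 0 = 0 := by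
  rw [largerRoot, mul_zero, add_zero, Real.sqrt_sq hb]
  ring

theorem sq_largerRoot {b c : ℝ} (hc : 0 ≤ c) :
    largerRoot b c ^ 2 + b * largerRoot b c - c = 0 := by
  have := Real.sq_sqrt (show 0 ≤ b ^ 2 + 4 * c by positivity)
  unfold largerRoot
  linear_combination this / 4

theorem le_largerRoot {b c t : ℝ} (h : t ^ 2 + b * t - c ≤ 0) : t ≤ largerRoot b c := by
  have : 2 * t + b ≤ √(b ^ 2 + 4 * c) := Real.le_sqrt_of_sq_le (by linarith)
  unfold largerRoot
  linarith

end Bound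

/-! ### Spectral Turán bound and equality -/

section CliqueBound

/-- The linear coefficient of the quadratic equation satisfied by `q₁ - n` for the Turán graph. -/
noncomputable def turanLinearCoeff (k ω r : ℕ) : ℝ := 4 * k + 2 - (k * ω + r)

/-- Minus the constant coefficient of the quadratic equation satisfied by `q₁ - n` for the Turán
graph. -/
noncomputable def turanConstCoeff (k ω : ℕ) : ℝ := 2 * k * (k + 1) * (ω - 2)

theorem turanConstCoeff_nonneg (k : ℕ) {ω : ℕ} (hω : 2 ≤ ω) : 0 ≤ turanConstCoeff k ω := by
  have : (2 : ℝ) ≤ ω := by exact_mod_cast hω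
  exact mul_nonneg (by positivity) (by linarith)

theorem card_add_largerRoot_eq (k ω r : ℕ) :
    ((k * ω + r : ℕ) : ℝ) + largerRoot (turanLinearCoeff k ω r) (turanConstCoeff k ω) =
      ((3 * (ω : ℝ) - 4) * k + 3 * r - 2 +
        √((k : ℝ) ^ 2 * (ω : ℝ) ^ 2 + ((2 * (r : ℝ) + 4) * ω - 8 * r) * k
          + ((r : ℝ) - 2) ^ 2)) / 2 := by
  have h : turanLinearCoeff k ω r ^ 2 + 4 * turanConstCoeff k ω =
      (k : ℝ) ^ 2 * (ω : ℝ) ^ 2 + ((2 * (r : ℝ) + 4) * ω - 8 * r) * k + ((r : ℝ) - 2) ^ 2 := by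
    unfold turanLinearCoeff turanConstCoeff
    ring
  rw [largerRoot, h, turanLinearCoeff]
  push_cast
  ring

theorem largerRoot_turan_two {k r : ℕ} (hr : r < 2) :
    largerRoot (turanLinearCoeff k 2 r) (turanConstCoeff k 2) = 0 := by
  have : (r : ℝ) ≤ 1 := by exact_mod_cast Nat.le_of_lt_succ hr
  have hk : (0 : ℝ) ≤ k := Nat.cast_nonneg k
  rw [show turanConstCoeff k 2 = 0 by simp [turanConstCoeff], largerRoot_zero]
  unfold turanLinearCoeff
  push_cast
  linarith

variable {V : Type*} [Fintype V] {k ω r : ℕ}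

theorem sum_class_card_eq_one_iff (hn : Fintype.card V = k * ω + r) (c : V → Fin ω) {t : ℝ}
    (ht : 0 < t) :
    ∑ i, (#{w | c w = i} : ℝ) / (t + 2 * #{w | c w = i}) = 1 ↔
      t ^ 2 + turanLinearCoeff k ω r * t - turanConstCoeff k ω +
        ∑ i, 2 * t * (((#{w | c w = i} : ℝ) - k) * (#{w | c w = i} - k - 1)) /
          (t + 2 * #{w | c w = i}) = 0 := by
  have hs : ∑ i, #{w | c w = i} = k * ω + r := by
    rw [← hn, ← card_univ, card_eq_sum_card_fiberwise (f := c) (t := univ) (by simp)]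
  have hpos : (t + 2 * (k : ℝ)) * (t + 2 * k + 2) ≠ 0 := by positivity
  rw [sum_div_add_two_mul_eq (Fintype.card_fin ω) hs ht, sub_eq_self, div_eq_zero_iff,
    or_iff_left hpos, turanLinearCoeff, turanConstCoeff]

theorem balance_defect_nonneg (c : V → Fin ω) {t : ℝ} (ht : 0 < t) (i : Fin ω) :
    0 ≤ 2 * t * (((#{w | c w = i} : ℝ) - k) * (#{w | c w = i} - k - 1)) /
      (t + 2 * #{w | c w = i}) :=
  div_nonneg (mul_nonneg (by positivity) (sub_mul_sub_sub_one_nonneg _ _)) (by positivity)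

theorem balance_defect_eq_zero_iff (c : V → Fin ω) {t : ℝ} (ht : 0 < t) (i : Fin ω) :
    2 * t * (((#{w | c w = i} : ℝ) - k) * (#{w | c w = i} - k - 1)) /
      (t + 2 * #{w | c w = i}) = 0 ↔ #{w | c w = i} = k ∨ #{w | c w = i} = k + 1 := by
  have h1 : t + 2 * (#{w | c w = i} : ℝ) ≠ 0 := by positivity
  have h2 : 2 * t ≠ 0 := by positivity
  rw [div_eq_zero_iff, or_iff_left h1, mul_eq_zero, or_iff_right h2, mul_eq_zero, sub_eq_zero,
    sub_sub, sub_eq_zero]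
  norm_cast

variable [DecidableEq V] {G : SimpleGraph V} [DecidableRel G.Adj] {c : V → Fin ω}

/-- The bound for complete multipartite graphs, together with the balance of the classes in the
case of equality. -/
theorem signlessLapSpectralRadius_le_of_multipartite [Nonempty V] (hω : 2 ≤ ω)
    (hn : Fintype.card V = k * ω + r) (hc : ∀ u v, G.Adj u v ↔ c u ≠ c v) :
    G.signlessLapSpectralRadius ≤
        Fintype.card V + largerRoot (turanLinearCoeff k ω r) (turanConstCoeff k ω) ∧
      (0 < largerRoot (turanLinearCoeff k ω r) (turanConstCoeff k ω) →
        G.signlessLapSpectralRadius =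
          Fintype.card V + largerRoot (turanLinearCoeff k ω r) (turanConstCoeff k ω) →
        ∀ i, #{w | c w = i} = k ∨ #{w | c w = i} = k + 1) := by
  obtain ⟨x, hx, -, h⟩ := G.exists_nonneg_eigenvector
  obtain ⟨t, ht⟩ : ∃ t, G.signlessLapSpectralRadius = Fintype.card V + t :=
    ⟨_, (add_sub_cancel _ _).symm⟩
  rw [ht] at h ⊢
  have hroot := sq_largerRoot (b := turanLinearCoeff k ω r) (turanConstCoeff_nonneg k hω)
  refine ⟨add_le_add_right ?_ _, fun hpos heq => ?_⟩
  · rcases le_or_gt t 0 with ht0 | ht0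
    · exact ht0.trans (largerRoot_nonneg (turanConstCoeff_nonneg k hω))
    · have h1 := (sum_class_card_eq_one_iff hn c ht0).1 (sum_class_card_div_eq_one hc hx ht0 h)
      have h2 := sum_nonneg fun i (_ : i ∈ univ) => balance_defect_nonneg (k := k) c ht0 i
      exact le_largerRoot (by linarith)
  · rw [add_right_inj] at heq
    rw [← heq] at hpos hroot
    have h1 := (sum_class_card_eq_one_iff hn c hpos).1 (sum_class_card_div_eq_one hc hx hpos h)
    rw [hroot, zero_add,
      sum_eq_zero_iff_of_nonneg fun i _ => balance_defect_nonneg (k := k) c hpos i] at h1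
    exact fun i => (balance_defect_eq_zero_iff c hpos i).1 (h1 i (mem_univ i))

theorem le_signlessLapSpectralRadius_of_balanced [Nonempty V] (hω : 2 ≤ ω)
    (hn : Fintype.card V = k * ω + r) (hc : ∀ u v, G.Adj u v ↔ c u ≠ c v)
    (hpos : 0 < largerRoot (turanLinearCoeff k ω r) (turanConstCoeff k ω))
    (hs : ∀ i, #{w | c w = i} = k ∨ #{w | c w = i} = k + 1) :
    Fintype.card V + largerRoot (turanLinearCoeff k ω r) (turanConstCoeff k ω) ≤
      G.signlessLapSpectralRadius := by
  refine card_add_le_signlessLapSpectralRadius hc hpos.le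
    ((sum_class_card_eq_one_iff hn c hpos).2 ?_)
  rw [sq_largerRoot (turanConstCoeff_nonneg k hω), zero_add]
  exact sum_eq_zero fun i _ => (balance_defect_eq_zero_iff c hpos i).2 (hs i)

theorem card_le_signlessLapSpectralRadius_of_bipartite [Nonempty V] {c : V → Fin 2}
    (hc : ∀ u v, G.Adj u v ↔ c u ≠ c v) (hs : ∀ i, 0 < #{w | c w = i}) :
    Fintype.card V ≤ G.signlessLapSpectralRadius := by
  have h := card_add_le_signlessLapSpectralRadius hc le_rfl (by
    have h1 : ∀ i, (#{w | c w = i} : ℝ) / (0 + 2 * #{w | c w = i}) = 1 / 2 := fun i => by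
      have : (0 : ℝ) < #{w | c w = i} := by exact_mod_cast hs i
      field_simp
      ring
    rw [sum_congr rfl fun i _ => h1 i]
    norm_num)
  rwa [add_zero] at h

/-- The spectral Turán bound for the signless Laplacian spectral radius. -/
theorem signlessLapSpectralRadius_le_of_cliqueFree [Nonempty V] (hω : 2 ≤ ω)
    (hn : Fintype.card V = k * ω + r) (hG : G.CliqueFree (ω + 1)) {a b : V} (hab : G.Adj a b) :
    G.signlessLapSpectralRadius ≤
      Fintype.card V + largerRoot (turanLinearCoeff k ω r) (turanConstCoeff k ω) := by
  obtain ⟨H, _, hH, hmax⟩ := G.exists_isMax_signlessLapSpectralRadius (ω + 1) hG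
  obtain ⟨c, hc⟩ := exists_coloring_of_isCompleteMultipartite
    (H.isCompleteMultipartite_of_isMax hH
      ((G.signlessLapSpectralRadius_pos hab).trans_le (hmax G hG)) hmax) hH
  exact (hmax G hG).trans (signlessLapSpectralRadius_le_of_multipartite hω hn hc).1

/-- A clique-free graph attaining the bound is complete multipartite. -/
theorem exists_coloring_of_signlessLapSpectralRadius_eq [Nonempty V] (hω : 2 ≤ ω)
    (hn : Fintype.card V = k * ω + r) (hG : G.CliqueFree (ω + 1)) {a b : V} (hab : G.Adj a b)
    (heq : G.signlessLapSpectralRadius =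
      Fintype.card V + largerRoot (turanLinearCoeff k ω r) (turanConstCoeff k ω)) :
    ∃ c : V → Fin ω, ∀ u v, G.Adj u v ↔ c u ≠ c v := by
  refine exists_coloring_of_isCompleteMultipartite (G.isCompleteMultipartite_of_isMax hG
    (G.signlessLapSpectralRadius_pos hab) fun H _ hH => ?_) hG
  by_cases hedge : ∃ u v, H.Adj u v
  · obtain ⟨u, v, huv⟩ := hedge
    exact heq ▸ signlessLapSpectralRadius_le_of_cliqueFree hω hn hH huv
  -- The bound was proved for graphs with an edge; an edgeless graph has radius `0`.
  · push Not at hedge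
    obtain ⟨x, hx, -, h⟩ := H.exists_nonneg_eigenvector
    have h0 : H.signlessLapMatrix *ᵥ x = 0 := funext fun u => by
      rw [signlessLapMatrix_mulVec_apply]
      exact sum_eq_zero fun w _ => if_neg (hedge u w)
    rw [h0, eq_comm, smul_eq_zero, or_iff_left hx] at h
    exact h ▸ (G.signlessLapSpectralRadius_pos hab).le

end CliqueBound

end SimpleGraph

theorem theorem1p1 {V : Type*} [Fintype V] [DecidableEq V] (G : SimpleGraph V)
    [DecidableRel G.Adj] (hG : G.Connected) (n k ω r : ℕ)
    (hn : Fintype.card V = n) (hω : G.cliqueNum = ω) (hω2 : 2 ≤ ω)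
    (hnk : n = k * ω + r) (hr : r < ω) :
    G.signlessLapSpectralRadius ≤
        ((3 * (ω : ℝ) - 4) * k + 3 * r - 2 +
          √((k : ℝ) ^ 2 * (ω : ℝ) ^ 2 + ((2 * (r : ℝ) + 4) * ω - 8 * r) * k
            + ((r : ℝ) - 2) ^ 2)) / 2 ∧
      (G.signlessLapSpectralRadius =
          ((3 * (ω : ℝ) - 4) * k + 3 * r - 2 +
            √((k : ℝ) ^ 2 * (ω : ℝ) ^ 2 + ((2 * (r : ℝ) + 4) * ω - 8 * r) * k
              + ((r : ℝ) - 2) ^ 2)) / 2 ↔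
        (ω = 2 ∧ G.IsCompleteBipartite) ∨
          (3 ≤ ω ∧ Nonempty (G ≃g SimpleGraph.turanGraph n ω))) := by
  have hne : Nonempty V := hG.nonempty
  have hn' : Fintype.card V = k * ω + r := hn.trans hnk
  obtain ⟨s, hs⟩ := G.exists_isNClique_cliqueNum
  rw [hω] at hs
  have hfree : G.CliqueFree (ω + 1) := fun t ht => by
    have := ht.isClique.card_le_cliqueNum
    rw [ht.card_eq, hω] at this
    omega
  obtain ⟨a, ha, b, hb, hne_ab⟩ := Finset.one_lt_card.1 (show 1 < s.card by rw [hs.card_eq]; omega)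
  have hab : G.Adj a b := hs.isClique ha hb hne_ab
  have hk : 1 ≤ k := by
    have h1 : s.card ≤ Fintype.card V := s.card_le_univ
    rw [hs.card_eq, hn'] at h1
    by_contra h0
    obtain rfl : k = 0 := by omega
    omega
  have hroot_pos : 3 ≤ ω → 0 < SimpleGraph.largerRoot
      (SimpleGraph.turanLinearCoeff k ω r) (SimpleGraph.turanConstCoeff k ω) := by
    intro h3
    have h3' : (3 : ℝ) ≤ ω := by exact_mod_cast h3
    have hk' : (1 : ℝ) ≤ k := by exact_mod_cast hk
    exact SimpleGraph.largerRoot_pos (mul_pos (by positivity) (by linarith))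
  rw [← SimpleGraph.card_add_largerRoot_eq, ← hn']
  have hle := SimpleGraph.signlessLapSpectralRadius_le_of_cliqueFree hω2 hn' hfree hab
  refine ⟨hle, fun heq => ?_, ?_⟩
  · obtain ⟨c, hc⟩ := SimpleGraph.exists_coloring_of_signlessLapSpectralRadius_eq
      hω2 hn' hfree hab heq
    rcases hω2.eq_or_lt with rfl | h3
    · refine Or.inl ⟨rfl,
        SimpleGraph.isCompleteBipartite_iff.2 ⟨c, hc, fun i => Finset.card_pos.2 ?_⟩⟩
      have hcab := (hc a b).1 hab
      -- The ends of an edge use both colours, so neither class is empty.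
      have hi : ∀ i j l : Fin 2, i ≠ j → i = l ∨ j = l := by decide
      rcases hi _ _ i hcab with h | h
      · exact ⟨a, by simp [h]⟩
      · exact ⟨b, by simp [h]⟩
    · exact Or.inr ⟨h3, SimpleGraph.nonempty_iso_turanGraph_of_balanced hn hk hc
        ((SimpleGraph.signlessLapSpectralRadius_le_of_multipartite hω2 hn' hc).2
          (hroot_pos h3) heq)⟩
  · rintro (⟨rfl, hbip⟩ | ⟨h3, ⟨e⟩⟩)
    · obtain ⟨c, hc, hs⟩ := SimpleGraph.isCompleteBipartite_iff.1 hbip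
      rw [SimpleGraph.largerRoot_turan_two hr, add_zero] at hle ⊢
      exact le_antisymm hle (SimpleGraph.card_le_signlessLapSpectralRadius_of_bipartite hc hs)
    · obtain ⟨c, hc, hs⟩ := SimpleGraph.exists_balanced_coloring_of_iso_turanGraph
        (by omega) hnk hr e
      exact le_antisymm hle
        (SimpleGraph.le_signlessLapSpectralRadius_of_balanced hω2 hn' hc (hroot_pos h3) hs)
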